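/- Conventions. For a topological group $G$, a *$G$-flow* is a compact Hausdorff space with a continuous (left) action of $G$. A *$G$-map* between $G$-flows is a continuous equivariant map; an *extension* is a surjective $G$-map, and an *isomorphism* ($\simeq$) is a bijective $G$-map. A *subflow* is a nonempty closed $G$-invariant subset. An extension $\phi\colon Y\to X$ is *$G$-irreducible* if $\phi(Z)\neq X$ for every proper subflow $Z\subsetneq Y$. A *$G$-projective cover* of $X$ is a pair $(Y,\phi)$ where $\phi\colon Y\to X$ is a $G$-irreducible extension such that for every $G$-irreducible extension $\pi\colon Z\to X$ there is a $G$-map $\psi\colon Y\to Z$ with $\pi\circ\psi=\phi$; when $Y$ carries such a $\phi$ we write $\operatorname{Proj}_G(X)\simeq Y$. The *universal minimal flow* $M(G)$ is the (nonempty) minimal $G$-flow that is an extension of every minimal $G$-flow. The group $G$ is *extremely amenable* if every nonempty $G$-flow has a fixed point. For a closed subgroup $H\le G$, $\mathrm{Sa}(G/H)$ denotes the *Samuel compactification* of $G/H$: the Gelfand spectrum of the $C^*$-algebra of bounded functions $f\colon G/H\to\mathbb C$ that are right uniformly continuous (for every $\varepsilon>0$ there is a neighbourhood $U$ of $1_G$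 with $|f(ugH)-f(gH)|<\varepsilon$ for all $u\in U$, $g\in G$), with $G$ acting by $(g\cdot\chi)(f)=\chi\bigl(y\mapsto f(gy)\bigr)$. Theorem. Let $G$ be a Polish group, $X$ a $G$-flow, and $x\in X$ a point whose orbit $G\cdot x$ is comeager in $X$. Put $H=\operatorname{Stab}(x)$ and suppose that the universal minimal flow $M(H)$ of $H$ has a comeager orbit. Then there is an extremely amenable closed subgroup $H^*\le H$ with $M(H)\simeq \mathrm{Sa}(H/H^*)$ (an isomorphism of $H$-flows), and for every such $H^*$ one has $$\operatorname{Proj}_G(X)\simeq \mathrm{Sa}(G/H^*),$$ that is, there is a $G$-map $\phi\colon \mathrm{Sa}(G/H^*)\to X$ such that $(\mathrm{Sa}(G/H^*),\phi)$ is a $G$-projective cover of $X$. -/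

import Mathlib

open Topology MulAction
open scoped BoundedContinuousFunction

universe u v m w

noncomputable section

/-! ### Flows

A `G`-flow is a compact Hausdorff space `X` with a continuous action of `G`, that is
`[TopologicalSpace X] [CompactSpace X] [T2Space X] [MulAction G X] [ContinuousSMul G X]`. -/

/-- A `G`-map: a continuous equivariant map. -/
structure IsGMap (G : Type*) {X Y : Type*} [Group G]
    [TopologicalSpace X] [MulAction G X] [TopologicalSpace Y] [MulAction G Y]
    (f : X → Y) : Prop where
  continuous : Continuous f
  map_smul : ∀ (g : G) (x : X), f (g • x) = g • f x

/-- An extension: a surjective `G`-map. -/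
structure IsGExtension (G : Type*) {X Y : Type*} [Group G]
    [TopologicalSpace X] [MulAction G X] [TopologicalSpace Y] [MulAction G Y]
    (f : X → Y) : Prop extends IsGMap G f where
  surjective : Function.Surjective f

/-- Two flows are isomorphic if there is a bijective `G`-map between them. -/
def FlowIsomorphic (G X Y : Type*) [Group G]
    [TopologicalSpace X] [MulAction G X] [TopologicalSpace Y] [MulAction G Y] : Prop :=
  ∃ f : X → Y, IsGMap G f ∧ Function.Bijective f

/-- A subflow: a nonempty closed invariant subset. -/
structure IsSubflow (G : Type*) {X : Type*} [Group G] [TopologicalSpace X] [MulAction G X]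
    (Z : Set X) : Prop where
  nonempty : Z.Nonempty
  isClosed : IsClosed Z
  smul_mem : ∀ (g : G), ∀ z ∈ Z, g • z ∈ Z

/-- A `G`-irreducible extension: no proper subflow of `X` is mapped onto `Y`. -/
structure IsGIrreducible (G : Type*) {X Y : Type*} [Group G]
    [TopologicalSpace X] [MulAction G X] [TopologicalSpace Y] [MulAction G Y]
    (f : X → Y) : Prop extends IsGExtension G f where
  image_ne_univ : ∀ Z : Set X, IsSubflow G Z → Z ≠ Set.univ → f '' Z ≠ Set.univ

/-- `(Y, φ)` is a `G`-projective cover of the flow `X`: `φ` is a `G`-irreducible extension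
which factors through every `G`-irreducible extension of `X` (by a flow in the universe `w`). -/
structure IsGProjectiveCover (G : Type u) {X : Type v} {Y : Type m} [Group G]
    [TopologicalSpace G]
    [TopologicalSpace X] [MulAction G X] [TopologicalSpace Y] [MulAction G Y]
    (φ : Y → X) : Prop extends IsGIrreducible G φ where
  exists_lift : ∀ (Z : Type w) [TopologicalSpace Z] [CompactSpace Z] [T2Space Z]
    [MulAction G Z] [ContinuousSMul G Z] (π : Z → X), IsGIrreducible G π →
      ∃ ψ : Y → Z, IsGMap G ψ ∧ π ∘ ψ = φ

/-- The flow `M` is the universal minimal flow of `G`: it is minimal, and it is an extension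
of every minimal `G`-flow. (Every minimal `G`-flow is, up to isomorphism, a quotient of the Samuel
compactification of `G`, so it suffices to test on flows in the universe of `G`.) -/
structure IsUniversalMinimalFlow (G : Type u) (M : Type m) [Group G] [TopologicalSpace G]
    [TopologicalSpace M] [MulAction G M] : Prop where
  nonempty : Nonempty M
  isMinimal : MulAction.IsMinimal G M
  universal : ∀ (Y : Type u) [TopologicalSpace Y] [CompactSpace Y] [T2Space Y] [Nonempty Y]
    [MulAction G Y] [ContinuousSMul G Y] [MulAction.IsMinimal G Y],
      ∃ f : M → Y, IsGExtension G f

/-- `G` is extremely amenable: every nonempty `G`-flow has a fixed point. (It suffices to test on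
flows in the universe of `G`, as every nonempty `G`-flow receives a `G`-map from the Samuel
compactification of `G`.) -/
def ExtremelyAmenable (G : Type u) [Group G] [TopologicalSpace G] : Prop :=
  ∀ (Y : Type u) [TopologicalSpace Y] [CompactSpace Y] [T2Space Y] [Nonempty Y]
    [MulAction G Y] [ContinuousSMul G Y], (fixedPoints G Y).Nonempty

/-! ### The Samuel compactification of `G ⧸ H` -/

/-- Joint continuity of evaluation on the spectrum of a commutative Banach algebra. -/
theorem continuous_characterSpace_eval {T A : Type*} [TopologicalSpace T] [NormedCommRing A]
    [NormedAlgebra ℂ A] [NormOneClass A] [CompleteSpace A] {F : T → A} (hF : Continuous F) :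
    Continuous fun p : T × WeakDual.characterSpace ℂ A => p.2 (F p.1) := by
  refine continuous_iff_continuousAt.2 fun q => Metric.tendsto_nhds.2 fun ε hε => ?_
  have h1 : ∀ᶠ p : T × WeakDual.characterSpace ℂ A in 𝓝 q, dist (F p.1) (F q.1) < ε / 2 :=
    (hF.comp continuous_fst).continuousAt.eventually (Metric.ball_mem_nhds _ (half_pos hε))
  have hev : Continuous fun p : T × WeakDual.characterSpace ℂ A => p.2 (F q.1) :=
    (WeakDual.eval_continuous (F q.1)).comp (continuous_subtype_val.comp continuous_snd)
  have h2 : ∀ᶠ p : T × WeakDual.characterSpace ℂ A in 𝓝 q,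
      dist (p.2 (F q.1)) (q.2 (F q.1)) < ε / 2 :=
    hev.continuousAt.eventually (Metric.ball_mem_nhds _ (half_pos hε))
  filter_upwards [h1, h2] with p hp1 hp2
  have h3 : dist (p.2 (F p.1)) (p.2 (F q.1)) ≤ dist (F p.1) (F q.1) := by
    rw [dist_eq_norm, dist_eq_norm, ← map_sub]
    exact AlgHom.norm_apply_le_self p.2 (F p.1 - F q.1)
  linarith [dist_triangle (p.2 (F p.1)) (p.2 (F q.1)) (q.2 (F q.1))]

section Samuel

variable {G : Type u} [Group G] [TopologicalSpace G]

/-- The `C⋆`-algebra of bounded right uniformly continuous functions on `G ⧸ H`: for every `ε`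
there is a neighbourhood `U` of `1` with `‖f (u g H) - f (g H)‖ < ε` for all `u ∈ U`, `g ∈ G`. -/
def RUC (H : Subgroup G) : StarSubalgebra ℂ ((G ⧸ H) →ᵇ ℂ) where
  carrier := {f | ∀ ε > 0, ∃ U ∈ 𝓝 (1 : G), ∀ u ∈ U, ∀ y : G ⧸ H, ‖f (u • y) - f y‖ < ε}
  algebraMap_mem' c ε hε := ⟨Set.univ, Filter.univ_mem, fun u _ y => by
    simpa [BoundedContinuousFunction.algebraMap_apply] using hε⟩
  add_mem' {f g} hf hg ε hε := by
    obtain ⟨U, hU, hfU⟩ := hf (ε / 2) (by positivity)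
    obtain ⟨V, hV, hgV⟩ := hg (ε / 2) (by positivity)
    refine ⟨U ∩ V, Filter.inter_mem hU hV, fun u hu y => ?_⟩
    calc ‖(f + g) (u • y) - (f + g) y‖ = ‖(f (u • y) - f y) + (g (u • y) - g y)‖ := by
          congr 1; simp only [BoundedContinuousFunction.coe_add, Pi.add_apply]; ring
      _ ≤ ‖f (u • y) - f y‖ + ‖g (u • y) - g y‖ := norm_add_le _ _
      _ < ε := by linarith [hfU u hu.1 y, hgV u hu.2 y]
  mul_mem' {f g} hf hg ε hε := by
    obtain ⟨U, hU, hfU⟩ := hf (ε / (2 * (‖g‖ + 1))) (by positivity)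
    obtain ⟨V, hV, hgV⟩ := hg (ε / (2 * (‖f‖ + 1))) (by positivity)
    refine ⟨U ∩ V, Filter.inter_mem hU hV, fun u hu y => ?_⟩
    have h1 := hfU u hu.1 y
    have h2 := hgV u hu.2 y
    have h3 : ‖g (u • y)‖ ≤ ‖g‖ + 1 := (g.norm_coe_le_norm _).trans (by linarith)
    have h4 : ‖f y‖ ≤ ‖f‖ + 1 := (f.norm_coe_le_norm _).trans (by linarith)
    rw [lt_div_iff₀ (by positivity)] at h1 h2
    calc ‖(f * g) (u • y) - (f * g) y‖
          = ‖(f (u • y) - f y) * g (u • y) + f y * (g (u • y) - g y)‖ := by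
          congr 1; simp only [BoundedContinuousFunction.coe_mul, Pi.mul_apply]; ring
      _ ≤ ‖f (u • y) - f y‖ * ‖g (u • y)‖ + ‖f y‖ * ‖g (u • y) - g y‖ := by
          simpa only [norm_mul] using norm_add_le ((f (u • y) - f y) * g (u • y))
            (f y * (g (u • y) - g y))
      _ ≤ ‖f (u • y) - f y‖ * (‖g‖ + 1) + (‖f‖ + 1) * ‖g (u • y) - g y‖ := by gcongr
      _ < ε := by linarith
  star_mem' {f} hf ε hε := by
    obtain ⟨U, hU, hfU⟩ := hf ε hε
    refine ⟨U, hU, fun u hu y => ?_⟩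
    simpa only [BoundedContinuousFunction.star_apply, ← star_sub, norm_star] using hfU u hu y

theorem RUC.isClosed (H : Subgroup G) : IsClosed (RUC H : Set ((G ⧸ H) →ᵇ ℂ)) := by
  refine isClosed_of_closure_subset fun f hf ε hε => ?_
  obtain ⟨g, hg, hfg⟩ := Metric.mem_closure_iff.1 hf (ε / 3) (by positivity)
  obtain ⟨U, hU, hgU⟩ := hg (ε / 3) (by positivity)
  refine ⟨U, hU, fun u hu y => ?_⟩
  have h1 := (BoundedContinuousFunction.dist_coe_le_dist (f := f) (g := g) (u • y)).trans_lt hfg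
  have h2 := (BoundedContinuousFunction.dist_coe_le_dist (f := f) (g := g) y).trans_lt hfg
  have h3 := hgU u hu y
  rw [← dist_eq_norm] at h3 ⊢
  have h4 := dist_triangle4 (f (u • y)) (g (u • y)) (g y) (f y)
  rw [dist_comm (g y)] at h4
  linarith

instance (H : Subgroup G) : CompleteSpace (RUC H) :=
  (RUC.isClosed H).completeSpace_coe

variable [IsTopologicalGroup G]

/-- Left translation `f ↦ (y ↦ f (g • y))` on right uniformly continuous functions. -/
def RUC.translate (H : Subgroup G) (g : G) : RUC H →⋆ₐ[ℂ] RUC H where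
  toFun f := ⟨f.1.compContinuous ⟨fun y => g • y, continuous_const_smul g⟩, fun ε hε => by
    obtain ⟨U, hU, hfU⟩ := f.2 ε hε
    have hc : Filter.Tendsto (fun u : G => g * u * g⁻¹) (𝓝 1) (𝓝 1) := by
      have : Continuous fun u : G => g * u * g⁻¹ := by fun_prop
      simpa using this.tendsto 1
    refine ⟨_, hc hU, fun u hu y => ?_⟩
    simpa [smul_smul] using hfU _ hu (g • y)⟩
  map_one' := rfl
  map_mul' _ _ := rfl
  map_zero' := rfl
  map_add' _ _ := rfl
  commutes' _ := rfl
  map_star' _ := rfl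

/-- The Samuel compactification of `G ⧸ H`: the Gelfand spectrum (with the weak-⋆ topology) of the
algebra of bounded right uniformly continuous functions on `G ⧸ H`. -/
def Samuel (H : Subgroup G) : Type u := WeakDual.characterSpace ℂ (RUC H)

namespace Samuel

variable (H : Subgroup G)

instance : TopologicalSpace (Samuel H) :=
  inferInstanceAs (TopologicalSpace (WeakDual.characterSpace ℂ (RUC H)))

instance : CompactSpace (Samuel H) :=
  inferInstanceAs (CompactSpace (WeakDual.characterSpace ℂ (RUC H)))

instance : T2Space (Samuel H) :=
  inferInstanceAs (T2Space (WeakDual.characterSpace ℂ (RUC H)))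

/-- The action of `G` on the Samuel compactification, `(g • χ) f = χ (y ↦ f (g • y))`; it extends
the action of `G` on `G ⧸ H`. -/
instance : MulAction G (Samuel H) where
  smul g χ := WeakDual.CharacterSpace.compContinuousMap (RUC.translate H g) χ
  one_smul χ := by
    refine Subtype.ext (DFunLike.ext _ _ fun f => ?_)
    change χ.1 (RUC.translate H 1 f) = χ.1 f
    congr 1
    ext y
    exact congrArg f.1 (one_smul G y)
  mul_smul g h χ := by
    refine Subtype.ext (DFunLike.ext _ _ fun f => ?_)
    change χ.1 (RUC.translate H (g * h) f) = χ.1 (RUC.translate H h (RUC.translate H g f))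
    congr 1
    ext y
    exact congrArg f.1 (mul_smul g h y)

theorem continuous_translate (f : RUC H) : Continuous fun g : G => RUC.translate H g f := by
  refine continuous_iff_continuousAt.2 fun g => Metric.tendsto_nhds.2 fun ε hε => ?_
  obtain ⟨U, hU, hfU⟩ := f.2 (ε / 2) (by positivity)
  have hc : Filter.Tendsto (fun k : G => k * g⁻¹) (𝓝 g) (𝓝 1) := by
    have : Continuous fun k : G => k * g⁻¹ := by fun_prop
    simpa using this.tendsto g
  filter_upwards [hc hU] with k hk
  refine lt_of_le_of_lt ?_ (half_lt_self hε)
  refine (BoundedContinuousFunction.dist_le (by positivity)).2 fun y => ?_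
  have := (hfU _ hk (g • y)).le
  rw [smul_smul, inv_mul_cancel_right, ← dist_eq_norm] at this
  exact this

instance : ContinuousSMul G (Samuel H) where
  continuous_smul :=
    Continuous.subtype_mk
      (WeakDual.continuous_of_continuous_eval fun f =>
        continuous_characterSpace_eval (continuous_translate H f)) _

end Samuel

end Samuel

end

/-!
By the argument of Effros, a point `x` with a comeager orbit is a point of micro-transitivity. This
controls fibres: if a `G`-map `S(G/K) → X` sends the base point `b` to `x`, then every point over
`x` lies in the orbit closure of `b` under `H = Stab(x)`, which for `K ≤ H` is a quotient of
`S(H/K)`. If `S(H/K) ≃ M(H)` is minimal, then all points over `x` have the same `H`-orbit closure,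
hence dense `G`-orbits, and `S(G/K) → X` is irreducible. If `K` is extremely amenable, it has a
fixed point over `x` in every extension of `X`, to which the base point can be mapped.

Such a `K` is the stabilizer of a point `p` of micro-transitivity of `M(H)`. Only the base point of
`S(H/K)` lies over `p`, so `S(H/K)` is minimal, and by coalescence of `M(H)`, a consequence of
Ellis' theorem on idempotents, it is isomorphic to `M(H)`. Again by coalescence, `K` fixes each
point `q` over `p` of a minimal subflow of `S(H)`; as `q` lies in the orbit closure of the base
point under `K`, which is a copy of `S(K)`, every `K`-flow has a fixed point.
-/

noncomputable section

section UniformUrysohn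

open Filter
open scoped Uniformity SetRel

theorem exists_uniformSpace_ge_isCountablyGenerated {X : Type*} [u : UniformSpace X]
    {V : SetRel X X} (hV : V ∈ 𝓤 X) :
    ∃ u' : UniformSpace X, u ≤ u' ∧ V ∈ 𝓤[u'] ∧ 𝓤[u'].IsCountablyGenerated := by
  choose next next_mem next_symm next_comp using
    fun W : {W : SetRel X X // W ∈ 𝓤 X} => comp_symm_mem_uniformity_sets W.2
  let W (n : ℕ) : {W : SetRel X X // W ∈ 𝓤 X} :=
    n.rec ⟨V, hV⟩ fun _ W => ⟨next W, next_mem W⟩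
  have W_symm (n : ℕ) : (W (n + 1)).1.IsSymm := next_symm (W n)
  have W_comp (n : ℕ) : (W (n + 1)).1 ○ (W (n + 1)).1 ⊆ (W n).1 := next_comp (W n)
  have W_refl (n : ℕ) (x : X) : (x, x) ∈ (W n).1 := refl_mem_uniformity (W n).2
  have W_succ (n : ℕ) : (W (n + 1)).1 ⊆ (W n).1 := fun ⟨x, _⟩ hp =>
    W_comp n ⟨x, W_refl (n + 1) x, hp⟩
  have basis : (⨅ n, 𝓟 (W n).1).HasBasis (fun _ => True) fun n => (W n).1 :=
    hasBasis_iInf_principal (antitone_nat_of_succ_le W_succ).directed_ge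
  refine ⟨.ofCore
    { uniformity := ⨅ n, 𝓟 (W n).1
      refl := basis.ge_iff.2 fun n _ => ?_
      symm := basis.tendsto_iff basis |>.2 fun n _ => ⟨n + 1, trivial, fun p hp => ?_⟩
      comp := ?_ }, ?_, ?_, ?_⟩
  · rintro ⟨x, y⟩ rfl
    exact W_refl n x
  · exact W_succ n ((W_symm n).symm _ _ hp)
  · exact basis.ge_iff.2 fun n _ => mem_of_superset
      (mem_lift' (basis.mem_of_mem (i := n + 1) trivial)) (W_comp n)
  · exact le_iInf fun n => le_principal_iff.2 (W n).2
  · exact basis.mem_of_mem (i := 0) trivial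
  · exact basis.isCountablyGenerated

theorem exists_uniformContinuous_one_zero_of_uniformly_separated {X : Type*} [u : UniformSpace X]
    {V : SetRel X X} (hV : V ∈ 𝓤 X) {A B : Set X} (hAB : ∀ a ∈ A, ∀ b ∈ B, (a, b) ∉ V) :
    ∃ f : X → ℝ, UniformContinuous f ∧ Set.EqOn f 1 A ∧ Set.EqOn f 0 B ∧
      ∀ x, f x ∈ Set.Icc 0 1 := by
  obtain ⟨u', hu', hVu', _⟩ := exists_uniformSpace_ge_isCountablyGenerated hV
  let := @UniformSpace.pseudoMetricSpace X u' _
  obtain ⟨δ, hδ, hδV⟩ := Metric.mem_uniformity_dist.1 hVu'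
  have hf : @UniformContinuous X ℝ u' _ fun x => (thickenedIndicator hδ A x : ℝ) :=
    uniformContinuous_subtype_val.comp (lipschitzWith_thickenedIndicator hδ A).uniformContinuous
  refine ⟨fun x => thickenedIndicator hδ A x, Tendsto.mono_left hf hu', fun a ha => ?_,
    fun b hb => ?_, fun x => ⟨NNReal.coe_nonneg _, thickenedIndicator_le_one hδ A x⟩⟩
  · simp [thickenedIndicator_one hδ A ha]
  · simp only [Pi.zero_apply, NNReal.coe_eq_zero]
    refine thickenedIndicator_zero hδ A fun hbA => ?_
    obtain ⟨a, ha, hba⟩ := Metric.mem_thickening_iff.1 hbA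
    exact hAB a ha b hb (hδV (dist_comm b a ▸ hba))

end UniformUrysohn

section NearlyOpen

open Filter

/-- A map is nearly open if the images of the neighbourhoods of `a` are dense in neighbourhoods of
the image of `a`. -/
def IsNearlyOpenMap {A X : Type*} [TopologicalSpace A] [TopologicalSpace X] (f : A → X) : Prop :=
  ∀ a, ∀ U ∈ 𝓝 a, closure (f '' U) ∈ 𝓝 (f a)

variable {A X : Type*} [PseudoMetricSpace A] [TopologicalSpace X] {f : A → X}

theorem tendsto_of_mem_closure_image_ball [RegularSpace X] {ι : Type*} {l : Filter ι} {a : A}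
    (hf : ContinuousAt f a) {c : ι → A} (hc : Tendsto c l (𝓝 a)) {r : ι → ℝ}
    (hr : Tendsto r l (𝓝 0)) {y : ι → X} (hy : ∀ i, y i ∈ closure (f '' Metric.ball (c i) (r i))) :
    Tendsto y l (𝓝 (f a)) := by
  refine (closed_nhds_basis (f a)).tendsto_right_iff.2 fun N ⟨hN, hN_closed⟩ => ?_
  obtain ⟨δ, hδ, hδN⟩ := Metric.nhds_basis_ball.mem_iff.1 (hf.preimage_mem_nhds hN)
  filter_upwards [hc.eventually (Metric.ball_mem_nhds a (half_pos hδ)),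
    hr.eventually (gt_mem_nhds (half_pos hδ))] with i hci hri
  refine closure_minimal (Set.image_subset_iff.2 fun b hb => hδN ?_) hN_closed (hy i)
  rw [Metric.mem_ball] at hb ⊢
  linarith [dist_triangle b (c i) a]

namespace IsNearlyOpenMap

theorem exists_closure_image_ball_mem_nhds (hf : IsNearlyOpenMap f) {a b : A} {r s t : ℝ}
    (hs : 0 < s) (ht : 0 < t) (hab : closure (f '' Metric.ball a r) ∈ 𝓝 (f b)) :
    ∃ a' ∈ Metric.ball a r, ∃ b' ∈ Metric.ball b s,
      closure (f '' Metric.ball a' t) ∈ 𝓝 (f b') := by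
  obtain ⟨y, ⟨hya, hyb⟩, a', ha', rfl⟩ := mem_closure_iff.1 (mem_of_mem_nhds hab) _
    (isOpen_interior.inter isOpen_interior)
    ⟨mem_interior_iff_mem_nhds.2 hab,
      mem_interior_iff_mem_nhds.2 (hf b _ (Metric.ball_mem_nhds b hs))⟩
  obtain ⟨y, hy, b', hb', rfl⟩ := mem_closure_iff.1 (interior_subset hyb) _ isOpen_interior
    (mem_interior_iff_mem_nhds.2 (hf a' _ (Metric.ball_mem_nhds a' ht)))
  exact ⟨a', ha', b', hb', mem_interior_iff_mem_nhds.1 hy⟩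

theorem exists_seq_closure_image_ball_mem_nhds (hf : IsNearlyOpenMap f) {r s : ℕ → ℝ}
    (hr : ∀ n, 0 < r n) (hs : ∀ n, 0 < s n) {a b : A}
    (hab : closure (f '' Metric.ball a (r 0)) ∈ 𝓝 (f b)) :
    ∃ u v : ℕ → A, u 0 = a ∧ v 0 = b ∧ ∀ n, dist (u n) (u (n + 1)) ≤ r n ∧
      dist (v n) (v (n + 1)) ≤ s n ∧ closure (f '' Metric.ball (u n) (r n)) ∈ 𝓝 (f (v n)) := by
  let P (n : ℕ) := {p : A × A // closure (f '' Metric.ball p.1 (r n)) ∈ 𝓝 (f p.2)}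
  have step (n : ℕ) (p : P n) :
      ∃ q : P (n + 1), dist p.1.1 q.1.1 ≤ r n ∧ dist p.1.2 q.1.2 ≤ s n := by
    obtain ⟨a', ha', b', hb', h⟩ :=
      hf.exists_closure_image_ball_mem_nhds (hs n) (hr (n + 1)) p.2
    exact ⟨⟨(a', b'), h⟩, (Metric.mem_ball'.1 ha').le, (Metric.mem_ball'.1 hb').le⟩
  choose next dist_fst dist_snd using step
  let S (n : ℕ) : P n := n.rec ⟨(a, b), hab⟩ next
  exact ⟨fun n => (S n).1.1, fun n => (S n).1.2, rfl, rfl,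
    fun n => ⟨dist_fst n (S n), dist_snd n (S n), (S n).2⟩⟩

/-- Successive approximation as in the open mapping theorem, except that both points have to be
corrected alternately, since `f` is not a homomorphism. -/
theorem exists_dist_le_apply_eq [CompleteSpace A] [T3Space X] (hf : IsNearlyOpenMap f)
    (hfc : Continuous f) {a b : A} {r s : ℝ} (hr : 0 < r) (hs : 0 < s)
    (hab : closure (f '' Metric.ball a (r / 2)) ∈ 𝓝 (f b)) :
    ∃ a' b', dist a a' ≤ r ∧ dist b b' ≤ s ∧ f a' = f b' := by
  obtain ⟨u, v, rfl, rfl, huv⟩ := hf.exists_seq_closure_image_ball_mem_nhds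
    (r := fun n => r / 2 / 2 ^ n) (s := fun n => s / 2 / 2 ^ n) (fun n => by positivity)
    (fun n => by positivity) (by simpa using hab)
  have hu n := (huv n).1
  have hv n := (huv n).2.1
  obtain ⟨a', ha'⟩ := cauchySeq_tendsto_of_complete (cauchySeq_of_le_geometric_two hu)
  obtain ⟨b', hb'⟩ := cauchySeq_tendsto_of_complete (cauchySeq_of_le_geometric_two hv)
  have radius_tendsto : Tendsto (fun n : ℕ => r / 2 / 2 ^ n) atTop (𝓝 0) :=
    tendsto_const_nhds.div_atTop (tendsto_pow_atTop_atTop_of_one_lt one_lt_two)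
  exact ⟨a', b', dist_le_of_le_geometric_two_of_tendsto₀ hu ha',
    dist_le_of_le_geometric_two_of_tendsto₀ hv hb',
    tendsto_nhds_unique (tendsto_of_mem_closure_image_ball hfc.continuousAt ha' radius_tendsto
      fun n => mem_of_mem_nhds (huv n).2.2) ((hfc.tendsto b').comp hb')⟩

end IsNearlyOpenMap

end NearlyOpen

section Microtransitive

open scoped Pointwise

theorem image_smul_smul {G X : Type*} [Group G] [MulAction G X] (x : X) (g : G) (U : Set G) :
    (fun a : G => a • x) '' (g • U) = g • (fun a : G => a • x) '' U :=
  Set.image_smul_comm _ _ _ fun a => mul_smul g a x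

variable {G X : Type*} [Group G] [TopologicalSpace G] [IsTopologicalGroup G]
  [TopologicalSpace X] [MulAction G X]

theorem isNearlyOpenMap_smul_of_not_isMeagre_orbit [LindelofSpace G]
    [ContinuousConstSMul G X] {x : X} (hx : ¬ IsMeagre (orbit G x)) :
    IsNearlyOpenMap fun g : G => g • x := by
  suffices near_one : ∀ U ∈ 𝓝 (1 : G), closure ((fun g : G => g • x) '' U) ∈ 𝓝 x by
    intro a U hU
    have hU' : a⁻¹ • U ∈ 𝓝 (1 : G) := by simpa using smul_mem_nhds_smul a⁻¹ hU
    have := smul_mem_nhds_smul a (near_one _ hU')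
    rwa [← closure_smul, ← image_smul_smul, smul_inv_smul] at this
  intro U hU
  obtain ⟨V, hV, -, hV_inv, hVU⟩ := exists_closed_nhds_one_inv_eq_mul_subset hU
  obtain ⟨S, hS, hS_univ⟩ := LindelofSpace.elim_nhds_subcover (fun g : G => g • V)
    fun g => by simpa using smul_mem_nhds_smul g hV
  have orbit_eq : orbit G x = ⋃ g ∈ S, (fun a : G => a • x) '' (g • V) := by
    rw [← Set.image_iUnion₂, hS_univ, Set.image_univ, orbit]
  obtain ⟨g, -, hg⟩ := exists_of_not_isMeagre_biUnion hS (orbit_eq ▸ hx)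
  obtain ⟨y, hy⟩ := Set.nonempty_iff_ne_empty.2 (mt IsNowhereDense.isMeagre hg)
  obtain ⟨_, hgv, _, ⟨v, hv, rfl⟩, rfl⟩ :=
    mem_closure_iff.1 (interior_subset hy) _ isOpen_interior hy
  have := smul_mem_nhds_smul (g • v)⁻¹ (mem_interior_iff_mem_nhds.1 hgv)
  rw [← closure_smul, ← image_smul_smul, inv_smul_smul] at this
  refine Filter.mem_of_superset this (closure_mono (Set.image_mono ?_))
  rintro _ ⟨_, ⟨w, hw, rfl⟩, rfl⟩
  have translate_eq : (g • v)⁻¹ • g • w = v⁻¹ * w := by simp [mul_assoc]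
  have : v⁻¹ * w ∈ V * V := Set.mul_mem_mul (by rwa [← hV_inv, Set.inv_mem_inv]) hw
  exact hVU (by rwa [← translate_eq] at this)

/-- The point `x` is a point of micro-transitivity of the action of `G` if its orbit map is open at
`1` as a map to the orbit of `x`. -/
def IsMicrotransitiveAt (G : Type*) {X : Type*} [Group G] [TopologicalSpace G] [TopologicalSpace X]
    [MulAction G X] (x : X) : Prop :=
  ∀ U ∈ 𝓝 (1 : G), (fun g : G => g • x) '' U ∈ 𝓝[orbit G x] x

theorem IsNearlyOpenMap.isMicrotransitiveAt [TopologicalSpace.IsCompletelyMetrizableSpace G]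
    [T3Space X] [ContinuousSMul G X] {x : X} (hx : IsNearlyOpenMap fun g : G => g • x) :
    IsMicrotransitiveAt G x := by
  let := TopologicalSpace.upgradeIsCompletelyMetrizable G
  intro U hU
  obtain ⟨V, hV, -, -, hVU⟩ := exists_closed_nhds_one_inv_eq_mul_subset hU
  obtain ⟨r, hr, hrV⟩ := Metric.nhds_basis_closedBall.mem_iff.1 hV
  have hW : closure ((fun g : G => g • x) '' Metric.ball 1 (r / 2)) ∈ 𝓝 x := by
    simpa using hx 1 _ (Metric.ball_mem_nhds 1 (half_pos hr))
  refine mem_nhdsWithin.2 ⟨_, isOpen_interior, mem_interior_iff_mem_nhds.2 hW, ?_⟩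
  rintro _ ⟨hgW, g, rfl⟩
  have hVg : (fun b => g * b⁻¹) ⁻¹' V ∈ 𝓝 g :=
    ContinuousAt.preimage_mem_nhds (by fun_prop) (by simpa using hV)
  obtain ⟨s, hs, hsV⟩ := Metric.nhds_basis_closedBall.mem_iff.1 hVg
  obtain ⟨a, b, ha, hb, hab⟩ := hx.exists_dist_le_apply_eq
    (by fun_prop) hr hs (mem_interior_iff_mem_nhds.1 hgW)
  refine ⟨g * b⁻¹ * a, hVU (Set.mul_mem_mul (hsV (Metric.mem_closedBall'.2 hb))
    (hrV (Metric.mem_closedBall'.2 ha))), ?_⟩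
  simp only [mul_smul, hab, inv_smul_smul]

theorem isMicrotransitiveAt_of_not_isMeagre_orbit [PolishSpace G] [T3Space X] [ContinuousSMul G X]
    {x : X} (hx : ¬ IsMeagre (orbit G x)) : IsMicrotransitiveAt G x :=
  (isNearlyOpenMap_smul_of_not_isMeagre_orbit hx).isMicrotransitiveAt

end Microtransitive

section Flow

variable {G X Y Z : Type*} [Group G] [TopologicalSpace X] [MulAction G X]
  [TopologicalSpace Y] [MulAction G Y] [TopologicalSpace Z] [MulAction G Z]

namespace IsGMap

variable {f : X → Y}

theorem comp {g : Y → Z} (hg : IsGMap G g) (hf : IsGMap G f) : IsGMap G (g ∘ f) :=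
  ⟨hg.continuous.comp hf.continuous, fun a x => by
    simp only [Function.comp_apply, hf.map_smul, hg.map_smul]⟩

theorem restrict (hf : IsGMap G f) (H : Subgroup G) : IsGMap H f :=
  ⟨hf.continuous, fun a x => hf.map_smul a x⟩

theorem image_orbit (hf : IsGMap G f) (x : X) : f '' orbit G x = orbit G (f x) := by
  simp only [orbit, ← Set.range_comp, Function.comp_def, hf.map_smul]

theorem image_closure_orbit [CompactSpace X] [T2Space Y] (hf : IsGMap G f) (x : X) :
    f '' closure (orbit G x) = closure (orbit G (f x)) := by
  rw [← hf.image_orbit, hf.continuous.isClosedMap.closure_image_eq_of_continuous hf.continuous]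

theorem range_eq_closure_orbit [CompactSpace X] [T2Space Y] (hf : IsGMap G f) {x : X}
    (hx : Dense (orbit G x)) : Set.range f = closure (orbit G (f x)) := by
  rw [← hf.image_closure_orbit, hx.closure_eq, Set.image_univ]

theorem surjective_of_dense_orbit [CompactSpace X] [T2Space Y] (hf : IsGMap G f) {x : X}
    (hx : Dense (orbit G (f x))) : Function.Surjective f := by
  refine Set.range_eq_univ.1 (Set.univ_subset_iff.1 ?_)
  rw [← hx.closure_eq, ← hf.image_closure_orbit]
  exact Set.image_subset_range _ _

theorem surjective_of_isMinimal [CompactSpace X] [Nonempty X] [T2Space Y]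
    [MulAction.IsMinimal G Y] (hf : IsGMap G f) : Function.Surjective f :=
  hf.surjective_of_dense_orbit (dense_orbit G (f (Classical.arbitrary X)))

end IsGMap

theorem IsGExtension.isMinimal [MulAction.IsMinimal G X] {f : X → Y} (hf : IsGExtension G f) :
    MulAction.IsMinimal G Y where
  dense_orbit := hf.surjective.forall.2 fun x => by
    rw [← hf.image_orbit]
    exact hf.surjective.denseRange.dense_image hf.continuous (dense_orbit G x)

namespace FlowIsomorphic

theorem isMinimal [MulAction.IsMinimal G X] (h : FlowIsomorphic G X Y) :
    MulAction.IsMinimal G Y :=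
  let ⟨_, hf, hf_bij⟩ := h
  IsGExtension.isMinimal ⟨hf, hf_bij.surjective⟩

theorem symm [CompactSpace X] [T2Space Y] (h : FlowIsomorphic G X Y) : FlowIsomorphic G Y X := by
  obtain ⟨f, hf, hf_bij⟩ := h
  let e := Equiv.ofBijective f hf_bij
  have he : Continuous e := hf.continuous
  refine ⟨e.symm, ⟨he.continuous_symm_of_equiv_compact_to_t2, fun g y => ?_⟩, e.symm.bijective⟩
  rw [Equiv.symm_apply_eq]
  change g • y = f (g • e.symm y)
  rw [hf.map_smul]
  exact congrArg (g • ·) (e.apply_symm_apply y).symm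

end FlowIsomorphic

namespace IsSubflow

theorem closure_orbit_subset {N : Set X} (hN : IsSubflow G N) {x : X} (hx : x ∈ N) :
    closure (orbit G x) ⊆ N :=
  closure_minimal (Set.range_subset_iff.2 fun g => hN.smul_mem g x hx) hN.isClosed

theorem eq_univ_of_dense_orbit {N : Set X} (hN : IsSubflow G N) {x : X} (hx : x ∈ N)
    (hx_dense : Dense (orbit G x)) : N = Set.univ :=
  Set.univ_subset_iff.1 (hx_dense.closure_eq ▸ hN.closure_orbit_subset hx)

theorem closure_orbit [ContinuousConstSMul G X] (x : X) : IsSubflow G (closure (orbit G x)) where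
  nonempty := ⟨x, subset_closure (mem_orbit_self x)⟩
  isClosed := isClosed_closure
  smul_mem g _ hz := map_mem_closure (continuous_const_smul g) hz fun _ => mem_orbit_of_mem_orbit g

theorem image [CompactSpace X] [T2Space Y] {f : X → Y} (hf : IsGMap G f) {N : Set X}
    (hN : IsSubflow G N) : IsSubflow G (f '' N) where
  nonempty := hN.nonempty.image f
  isClosed := hf.continuous.isClosedMap _ hN.isClosed
  smul_mem g := Set.forall_mem_image.2 fun z hz => ⟨g • z, hN.smul_mem g z hz, hf.map_smul g z⟩

/-- A subflow as a flow in its own right. -/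
def toSubMulAction {N : Set X} (hN : IsSubflow G N) : SubMulAction G X where
  carrier := N
  smul_mem' g _ hz := hN.smul_mem g _ hz

instance {N : Set X} (hN : IsSubflow G N) : Nonempty hN.toSubMulAction := hN.nonempty.to_subtype

instance [CompactSpace X] {N : Set X} (hN : IsSubflow G N) : CompactSpace hN.toSubMulAction :=
  isCompact_iff_compactSpace.1 hN.isClosed.isCompact

instance [TopologicalSpace G] [ContinuousSMul G X] {N : Set X} (hN : IsSubflow G N) :
    ContinuousSMul G hN.toSubMulAction where
  continuous_smul := Continuous.subtype_mk (by fun_prop) _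

theorem isGMap_val {N : Set X} (hN : IsSubflow G N) :
    IsGMap G (Subtype.val : hN.toSubMulAction → X) :=
  ⟨continuous_subtype_val, fun _ _ => rfl⟩

theorem isMinimal_of_minimal [ContinuousConstSMul G X] {N : Set X}
    (hN : Minimal (IsSubflow G) N) : MulAction.IsMinimal G hN.prop.toSubMulAction where
  dense_orbit z := Subtype.dense_iff.2 <|
    (hN.le_of_le (.closure_orbit z.1) (hN.prop.closure_orbit_subset z.2)).trans
      (closure_mono (hN.prop.isGMap_val.image_orbit z).ge)

theorem exists_minimal [CompactSpace X] [Nonempty X] : ∃ N : Set X, Minimal (IsSubflow G) N := by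
  refine zorn_superset {N | IsSubflow G N} fun c hc hc_chain => ?_
  rcases c.eq_empty_or_nonempty with rfl | hc_ne
  · exact ⟨Set.univ, ⟨Set.univ_nonempty, isClosed_univ, fun _ _ _ => Set.mem_univ _⟩, by simp⟩
  have := hc_ne.to_subtype
  refine ⟨⋂₀ c, ⟨?_, isClosed_sInter fun N hN => (hc hN).isClosed, fun g z hz N hN =>
    (hc hN).smul_mem g z (hz N hN)⟩, fun N => Set.sInter_subset_of_mem⟩
  exact IsCompact.nonempty_sInter_of_directed_nonempty_isCompact_isClosed
    (fun N hN N' hN' => (hc_chain.total hN hN').elim (fun h => ⟨N, hN, subset_rfl, h⟩)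
      fun h => ⟨N', hN', h, subset_rfl⟩)
    (fun N hN => (hc hN).nonempty) (fun N hN => (hc hN).isClosed.isCompact)
    fun N hN => (hc hN).isClosed

end IsSubflow

theorem IsGExtension.isGIrreducible_of_dense_orbit {f : X → Y} (hf : IsGExtension G f) {y : Y}
    (h : ∀ z, f z = y → Dense (orbit G z)) : IsGIrreducible G f where
  toIsGExtension := hf
  image_ne_univ N hN hN_ne hN_image := by
    obtain ⟨z, hzN, hzy⟩ : y ∈ f '' N := hN_image ▸ Set.mem_univ y
    exact hN_ne (hN.eq_univ_of_dense_orbit hzN (h z hzy))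

theorem IsGIrreducible.isMinimal [CompactSpace X] [ContinuousConstSMul G X] [T2Space Y]
    [MulAction.IsMinimal G Y] {f : X → Y} (hf : IsGIrreducible G f) : MulAction.IsMinimal G X where
  dense_orbit x := by
    by_contra hx
    refine hf.image_ne_univ _ (.closure_orbit x) (mt dense_iff_closure_eq.2 hx) ?_
    rw [hf.image_closure_orbit, (dense_orbit G (f x)).closure_eq]

variable [TopologicalSpace G]

theorem exists_nhds_one_norm_smul_sub_lt {E : Type*} [SeminormedAddCommGroup E] [CompactSpace X]
    [ContinuousSMul G X] {f : X → E} (hf : Continuous f) {ε : ℝ} (hε : 0 < ε) :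
    ∃ U ∈ 𝓝 (1 : G), ∀ u ∈ U, ∀ x, ‖f (u • x) - f x‖ < ε := by
  have hopen : IsOpen {p : G × X | ‖f (p.1 • p.2) - f p.2‖ < ε} :=
    isOpen_lt (by fun_prop) continuous_const
  obtain ⟨U, V, hU, -, h1, hV, hUV⟩ := generalized_tube_lemma (s := {(1 : G)})
    (t := (Set.univ : Set X)) isCompact_singleton isCompact_univ hopen (by
      rintro ⟨a, x⟩ ⟨rfl, -⟩
      simpa using hε)
  exact ⟨U, hU.mem_nhds (h1 rfl), fun u hu x => hUV (Set.mk_mem_prod hu (hV (Set.mem_univ x)))⟩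

theorem isClosed_stabilizer [T1Space X] [ContinuousSMul G X] (x : X) :
    IsClosed (stabilizer G x : Set G) :=
  isClosed_singleton.preimage (continuous_id.smul (continuous_const (y := x)))

theorem IsMicrotransitiveAt.mem_closure_orbit_stabilizer [IsTopologicalGroup G]
    [ContinuousSMul G X] {f : X → Y} (hf : IsGMap G f) {y : Y}
    (hy : IsMicrotransitiveAt G y) {x z : X} (hx : f x = y) (hz : z ∈ closure (orbit G x))
    (hzy : f z = y) : z ∈ closure (orbit (stabilizer G y) x) := by
  subst hx
  refine mem_closure_iff_nhds.2 fun N hN => ?_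
  have smul_mem : ∀ᶠ p : G × X in 𝓝 1 ×ˢ 𝓝 z, p.1⁻¹ • p.2 ∈ N := by
    rw [← nhds_prod_eq]
    exact ContinuousAt.preimage_mem_nhds (by fun_prop) (by simpa using hN)
  obtain ⟨U, hU, W, hW, hUW⟩ := Filter.mem_prod_iff.1 smul_mem
  obtain ⟨V, hV, hVU⟩ := mem_nhdsWithin_iff_exists_mem_nhds_inter.1 (hy U hU)
  obtain ⟨_, ⟨hgW, hgV⟩, g, rfl⟩ := mem_closure_iff_nhds.1 hz _
    (Filter.inter_mem hW (hf.continuous.continuousAt.preimage_mem_nhds (hzy ▸ hV)))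
  rw [Set.mem_preimage, hf.map_smul] at hgV
  obtain ⟨a, haU, hag⟩ := hVU ⟨hgV, g, rfl⟩
  refine ⟨a⁻¹ • g • x, hUW (Set.mk_mem_prod haU hgW), ⟨a⁻¹ * g, ?_⟩, mul_smul a⁻¹ g x⟩
  simp only [mem_stabilizer_iff, mul_smul, ← hag, inv_smul_smul]

end Flow

namespace Samuel

section Canonical

variable {G : Type u} [Group G] [TopologicalSpace G] {H : Subgroup G}

/-- Evaluation of the points of the Samuel compactification, which are characters, at a function. -/
def eval (f : RUC H) (χ : Samuel H) : ℂ := χ.1 f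

variable (H) in
/-- The canonical map of `G ⧸ H` to its Samuel compactification. -/
def of (y : G ⧸ H) : Samuel H :=
  WeakDual.CharacterSpace.equivAlgHom.symm
    { toFun := fun f : RUC H => f.1 y
      map_one' := rfl
      map_mul' := fun _ _ => rfl
      map_zero' := rfl
      map_add' := fun _ _ => rfl
      commutes' := fun _ => rfl }

variable (H) in
/-- The image of the trivial coset in the Samuel compactification of `G ⧸ H`. -/
def base : Samuel H := of H (1 : G)

instance : Nonempty (Samuel H) := ⟨base H⟩

theorem eval_of (f : RUC H) (y : G ⧸ H) : eval f (of H y) = f.1 y := rfl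

theorem continuous_eval (f : RUC H) : Continuous (eval f) :=
  (WeakDual.eval_continuous f).comp continuous_subtype_val

/-- By Gelfand duality, a function separating a point from the range of `of H` would be the
Gelfand transform of a function that vanishes on `G ⧸ H`. -/
theorem denseRange_of : DenseRange (of H) := by
  by_contra hd
  obtain ⟨χ, hχ⟩ : ∃ χ, χ ∉ closure (Set.range (of H)) := by
    simpa only [DenseRange, Dense, not_forall] using hd
  obtain ⟨f, hf0, hf1, -⟩ := exists_continuous_zero_one_of_isClosed
    isClosed_closure (isClosed_singleton (x := χ)) (Set.disjoint_singleton_right.2 hχ)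
  let F : C(WeakDual.characterSpace ℂ (RUC H), ℂ) :=
    ⟨fun χ => ((f χ : ℝ) : ℂ), Complex.continuous_ofReal.comp f.continuous⟩
  have := RUC.isClosed H
  obtain ⟨a, ha⟩ := (gelfandTransform_bijective (RUC H)).2 F
  have eval_a (ψ : Samuel H) : eval a ψ = ((f ψ : ℝ) : ℂ) := DFunLike.congr_fun ha ψ
  have ha0 : a = 0 := by
    refine Subtype.ext (BoundedContinuousFunction.ext fun y => ?_)
    rw [← eval_of, eval_a, hf0 (subset_closure ⟨y, rfl⟩)]
    exact Complex.ofReal_zero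
  have h01 : (0 : ℂ) = ((f χ : ℝ) : ℂ) := by
    rw [← eval_a, ha0]
    exact (map_zero (show WeakDual.characterSpace ℂ (RUC H) from χ)).symm
  rw [hf1 rfl] at h01
  exact one_ne_zero (Complex.ofReal_injective h01).symm

variable [IsTopologicalGroup G]

theorem smul_base (g : G) : g • base H = of H g :=
  congrArg (of H) (congrArg QuotientGroup.mk (mul_one g))

theorem le_stabilizer_base : H ≤ stabilizer G (base H) := fun h hh => by
  rw [mem_stabilizer_iff, smul_base, base]
  exact congrArg (of H) (QuotientGroup.eq.2 (by simpa using hh))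

theorem dense_orbit_base : Dense (orbit G (base H)) := by
  refine denseRange_of.mono (Set.range_subset_iff.2 fun y => ?_)
  induction y using QuotientGroup.induction_on with
  | H g => exact ⟨g, smul_base g⟩

theorem gMap_ext {Y : Type*} [TopologicalSpace Y] [T2Space Y] [MulAction G Y]
    {f g : Samuel H → Y} (hf : IsGMap G f) (hg : IsGMap G g) (h : f (base H) = g (base H)) :
    f = g := by
  refine hf.continuous.ext_on dense_orbit_base hg.continuous ?_
  rintro _ ⟨a, rfl⟩
  simp only [hf.map_smul, hg.map_smul, h]

end Canonical

section Lift

variable {G : Type u} [Group G] [TopologicalSpace G] {H : Subgroup G}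
  {Y : Type*} [TopologicalSpace Y] [MulAction G Y] [ContinuousSMul G Y]

/-- The orbit map of a point fixed by `H`, as a map on `G ⧸ H`. -/
def orbitMap (y : Y) (hy : H ≤ stabilizer G y) : C(G ⧸ H, Y) where
  toFun q := Quotient.liftOn' q (fun g => g • y) fun a b hab => by
    have := hy (QuotientGroup.leftRel_apply.1 hab)
    rw [mem_stabilizer_iff, mul_smul, inv_smul_eq_iff] at this
    exact this.symm
  continuous_toFun := (continuous_id.smul continuous_const).quotient_liftOn' _

theorem orbitMap_smul (y : Y) (hy : H ≤ stabilizer G y) (g : G) (q : G ⧸ H) :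
    orbitMap y hy (g • q) = g • orbitMap y hy q := by
  induction q using QuotientGroup.induction_on with
  | H a => exact mul_smul g a y

variable [CompactSpace Y]

/-- The pullback of continuous functions on a flow along the orbit map of a point fixed by `H`. -/
def pullback (y : Y) (hy : H ≤ stabilizer G y) : C(Y, ℂ) →⋆ₐ[ℂ] RUC H where
  toFun f := ⟨(BoundedContinuousFunction.mkOfCompact f).compContinuous (orbitMap y hy),
    fun ε hε => by
      obtain ⟨U, hU, hfU⟩ := exists_nhds_one_norm_smul_sub_lt (G := G) f.continuous hε
      refine ⟨U, hU, fun u hu q => ?_⟩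
      simpa [orbitMap_smul] using hfU u hu (orbitMap y hy q)⟩
  map_one' := rfl
  map_mul' _ _ := rfl
  map_zero' := rfl
  map_add' _ _ := rfl
  commutes' _ := rfl
  map_star' _ := rfl

variable [T2Space Y]

/-- The extension of the orbit map of a point fixed by `H` to the Samuel compactification of
`G ⧸ H`, which is the spectrum of the pullback once `Y` is identified with the spectrum of
`C(Y, ℂ)`. -/
def lift (y : Y) (hy : H ≤ stabilizer G y) (χ : Samuel H) : Y :=
  (WeakDual.CharacterSpace.homeoEval Y ℂ).symm
    (WeakDual.CharacterSpace.compContinuousMap (pullback y hy) χ)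

theorem continuous_lift (y : Y) (hy : H ≤ stabilizer G y) : Continuous (lift y hy) :=
  (Homeomorph.continuous _).comp (ContinuousMap.continuous _)

theorem lift_of (y : Y) (hy : H ≤ stabilizer G y) (q : G ⧸ H) :
    lift y hy (of H q) = orbitMap y hy q :=
  (Homeomorph.symm_apply_eq _).2 rfl

theorem lift_base (y : Y) (hy : H ≤ stabilizer G y) : lift y hy (base H) = y :=
  (lift_of y hy _).trans (one_smul G y)

variable [IsTopologicalGroup G]

theorem isGMap_lift (y : Y) (hy : H ≤ stabilizer G y) : IsGMap G (lift y hy) where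
  continuous := continuous_lift y hy
  map_smul g := congrFun <| denseRange_of.equalizer
    ((continuous_lift y hy).comp (continuous_const_smul g)) ((continuous_lift y hy).const_smul g)
    (funext fun q => by
      have smul_of : g • of H q = of H (g • q) := rfl
      simp only [Function.comp_apply, smul_of, lift_of, orbitMap_smul])

theorem range_lift (y : Y) (hy : H ≤ stabilizer G y) :
    Set.range (lift y hy) = closure (orbit G y) := by
  rw [(isGMap_lift y hy).range_eq_closure_orbit dense_orbit_base, lift_base]

end Lift

end Samuel

namespace Samuel

section Ellis

variable {G : Type u} [Group G] [TopologicalSpace G] [IsTopologicalGroup G]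
  {Y : Type*} [TopologicalSpace Y] [CompactSpace Y] [T2Space Y] [MulAction G Y]
  [ContinuousSMul G Y]

theorem map_lift {Z : Type*} [TopologicalSpace Z] [CompactSpace Z] [T2Space Z] [MulAction G Z]
    [ContinuousSMul G Z] {H : Subgroup G} {f : Y → Z} (hf : IsGMap G f) {y : Y}
    (hy : H ≤ stabilizer G y) (hfy : H ≤ stabilizer G (f y)) (χ : Samuel H) :
    f (lift y hy χ) = lift (f y) hfy χ :=
  congrFun (gMap_ext (hf.comp (isGMap_lift y hy)) (isGMap_lift (f y) hfy)
    (by rw [Function.comp_apply, lift_base, lift_base])) χ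

theorem lift_mem {H : Subgroup G} {N : Set Y} (hN : IsSubflow G N) {y : Y} (hyN : y ∈ N)
    (hy : H ≤ stabilizer G y) (χ : Samuel H) : lift y hy χ ∈ N :=
  hN.closure_orbit_subset hyN ((range_lift y hy).le ⟨χ, rfl⟩)

/-- The Ellis semigroup structure on the Samuel compactification of `G`: right multiplication by
`q` is the unique `G`-map that sends the base point to `q`. -/
instance : Semigroup (Samuel (⊥ : Subgroup G)) where
  mul p q := lift q bot_le p
  mul_assoc p _ r := map_lift (isGMap_lift r bot_le) bot_le bot_le p

theorem isGMap_mul_right (q : Samuel (⊥ : Subgroup G)) : IsGMap G (· * q) :=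
  isGMap_lift q bot_le

section Minimal

variable {N : Set (Samuel (⊥ : Subgroup G))}

theorem image_mul_right_eq (hN : Minimal (IsSubflow G) N) {a : Samuel (⊥ : Subgroup G)}
    (ha : a ∈ N) : (· * a) '' N = N :=
  hN.eq_of_le (hN.prop.image (isGMap_mul_right a))
    (Set.image_subset_iff.2 fun _ _ => lift_mem hN.prop ha bot_le _)

theorem exists_mul_eq_self (hN : Minimal (IsSubflow G) N) :
    ∃ e ∈ N, ∀ q ∈ N, q * e = q := by
  obtain ⟨e, heN, hee⟩ := exists_idempotent_in_compact_subsemigroup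
    (fun q => (isGMap_mul_right q).continuous) N hN.prop.nonempty hN.prop.isClosed.isCompact
    fun p _ q hq => lift_mem hN.prop hq bot_le p
  refine ⟨e, heN, fun q hq => ?_⟩
  obtain ⟨p, -, rfl⟩ := (image_mul_right_eq hN heN).ge hq
  change p * e * e = p * e
  rw [mul_assoc, hee]

/-- With `b * a = e` and `c * b = e`, where `e` is a right identity of `N`, one has
`e * a = c * b * a = c`, so that right multiplication by `b` undoes that by `a`. -/
theorem injOn_mul_right (hN : Minimal (IsSubflow G) N) {a : Samuel (⊥ : Subgroup G)}
    (ha : a ∈ N) : Set.InjOn (· * a) N := by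
  obtain ⟨e, he, mul_e⟩ := exists_mul_eq_self hN
  obtain ⟨b, hb, hba : b * a = e⟩ := (image_mul_right_eq hN ha).ge he
  obtain ⟨c, hc, hcb : c * b = e⟩ := (image_mul_right_eq hN hb).ge he
  have e_mul_a : e * a = c := by rw [← hcb, mul_assoc, hba, mul_e c hc]
  refine Set.LeftInvOn.injOn (f₁' := (· * b)) fun q hq => ?_
  calc q * a * b = q * e * a * b := by rw [mul_e q hq]
    _ = q * (e * a * b) := by simp only [mul_assoc]
    _ = q := by rw [e_mul_a, hcb, mul_e q hq]

theorem injective_of_isMinimal (hN : Minimal (IsSubflow G) N) [Nonempty Y]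
    [MulAction.IsMinimal G Y] {f : Y → hN.prop.toSubMulAction} (hf : IsGMap G f) :
    Function.Injective f := by
  let y : Y := Classical.arbitrary Y
  have lift_surj : Set.range (fun q : hN.prop.toSubMulAction => lift y bot_le q.1) = Set.univ :=
    ((isGMap_lift y bot_le).comp hN.prop.isGMap_val).surjective_of_isMinimal.range_eq
  have f_lift (q : Samuel (⊥ : Subgroup G)) : (f (lift y bot_le q)).1 = q * (f y).1 :=
    map_lift (hN.prop.isGMap_val.comp hf) bot_le bot_le q
  rw [← Set.injOn_univ, ← lift_surj]
  rintro _ ⟨p, rfl⟩ _ ⟨q, rfl⟩ hpq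
  refine congrArg (lift y bot_le) (injOn_mul_right hN (f y).2 p.2 q.2 ?_)
  simpa only [f_lift] using congrArg Subtype.val hpq

end Minimal

end Ellis

end Samuel

theorem IsUniversalMinimalFlow.injective {G : Type u} [Group G] [TopologicalSpace G]
    [IsTopologicalGroup G] {M : Type m} [TopologicalSpace M] [MulAction G M]
    (hM : IsUniversalMinimalFlow G M) {Y : Type*} [TopologicalSpace Y] [CompactSpace Y] [T2Space Y]
    [Nonempty Y] [MulAction G Y] [ContinuousSMul G Y] [MulAction.IsMinimal G Y] {f : Y → M}
    (hf : IsGMap G f) : Function.Injective f := by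
  obtain ⟨N, hN⟩ := IsSubflow.exists_minimal (G := G) (X := Samuel (⊥ : Subgroup G))
  have := IsSubflow.isMinimal_of_minimal hN
  obtain ⟨π, hπ⟩ := hM.universal hN.prop.toSubMulAction
  exact (Samuel.injective_of_isMinimal hN (hπ.toIsGMap.comp hf)).of_comp

namespace Samuel

section SeparatedSets

open scoped Uniformity

section IsRightUniformGroup

variable {G : Type u} [Group G] [UniformSpace G] [IsRightUniformGroup G]

theorem exists_eval_smul_base_eq {f : G → ℂ} (hf : UniformContinuous f) {C : ℝ}
    (hC : ∀ g, ‖f g‖ ≤ C) : ∃ F : RUC (⊥ : Subgroup G), ∀ g : G, eval F (g • base ⊥) = f g := by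
  let F := BoundedContinuousFunction.ofNormedAddCommGroup
    (fun q => f (QuotientGroup.quotientBot q))
    (isQuotientMap_quotient_mk'.continuous_iff.2 hf.continuous) C fun q => hC _
  refine ⟨⟨F, fun ε hε => ?_⟩, fun g => by rw [smul_base]; rfl⟩
  have := hf (Metric.dist_mem_uniformity hε)
  rw [uniformity_eq_comap_mul_inv_nhds_one] at this
  obtain ⟨U, hU, hUf⟩ := this
  refine ⟨U, hU, fun u hu y => ?_⟩
  induction y using QuotientGroup.induction_on with
  | H g =>
    rw [← dist_eq_norm, dist_comm]
    exact @hUf (g, u * g) (by simpa using hu)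

theorem disjoint_closure_of_uniformly_separated {V : SetRel G G} (hV : V ∈ 𝓤 G) {A B : Set G}
    (hAB : ∀ a ∈ A, ∀ b ∈ B, (a, b) ∉ V) :
    Disjoint (closure ((· • base (⊥ : Subgroup G)) '' A))
      (closure ((· • base (⊥ : Subgroup G)) '' B)) := by
  obtain ⟨f, hf, hfA, hfB, hf01⟩ := exists_uniformContinuous_one_zero_of_uniformly_separated hV hAB
  obtain ⟨F, hF⟩ := exists_eval_smul_base_eq (f := fun g => (f g : ℂ)) (C := 1)
    (Complex.isometry_ofReal.uniformContinuous.comp hf) fun g => by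
      rw [Complex.norm_real, Real.norm_of_nonneg (hf01 g).1]
      exact (hf01 g).2
  have eval_eq {c : ℝ} {S : Set G} (hS : ∀ g ∈ S, f g = c) :
      closure ((· • base (⊥ : Subgroup G)) '' S) ⊆ eval F ⁻¹' {(c : ℂ)} :=
    closure_minimal (Set.image_subset_iff.2 fun g hg => by simp [hF, hS g hg])
      (isClosed_singleton.preimage (continuous_eval F))
  refine Set.disjoint_of_subset (eval_eq (c := 1) hfA) (eval_eq (c := 0) hfB) ?_
  exact Disjoint.preimage _ (by simp)

end IsRightUniformGroup

variable {G : Type u} [Group G] [TopologicalSpace G] [IsTopologicalGroup G]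

theorem disjoint_closure_of_smul_notMem {A B U : Set G} (hU : U ∈ 𝓝 (1 : G))
    (hAB : ∀ u ∈ U, ∀ a ∈ A, u * a ∉ B) :
    Disjoint (closure ((· • base (⊥ : Subgroup G)) '' A))
      (closure ((· • base (⊥ : Subgroup G)) '' B)) := by
  let := IsTopologicalGroup.rightUniformSpace G
  have : IsRightUniformGroup G := ⟨rfl⟩
  refine disjoint_closure_of_uniformly_separated (Filter.preimage_mem_comap hU)
    fun a ha b hb hab => hAB _ hab a ha ?_
  simpa using hb

variable {K : Subgroup G}

theorem lift_base_mem_closure {S : Set (Samuel (⊥ : Subgroup K))} (hS : IsOpen S)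
    {χ : Samuel (⊥ : Subgroup K)} (hχ : χ ∈ S) :
    lift (base (⊥ : Subgroup G)) bot_le χ ∈
      closure ((· • base (⊥ : Subgroup G)) '' (Subtype.val '' {k : K | k • base ⊥ ∈ S})) := by
  refine map_mem_closure (continuous_lift _ _)
    (dense_orbit_base.open_subset_closure_inter hS hχ) ?_
  rintro _ ⟨hk, k, rfl⟩
  refine ⟨k, ⟨k, hk, rfl⟩, ?_⟩
  rw [(isGMap_lift _ _).map_smul, lift_base]
  rfl

/-- Distinct points of the Samuel compactification of `K` lie in the closures of uniformly separated
subsets of `K`, and these are still uniformly separated in `G`. -/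
theorem injective_lift_base :
    Function.Injective (lift (base (⊥ : Subgroup G)) bot_le : Samuel (⊥ : Subgroup K) → _) := by
  intro χ ψ hχψ
  by_contra hne
  obtain ⟨f, hfχ, hfψ, -⟩ := exists_continuous_zero_one_of_isClosed (isClosed_singleton (x := χ))
    (isClosed_singleton (x := ψ)) (Set.disjoint_singleton.2 hne)
  obtain ⟨U, hU, hUf⟩ := exists_nhds_one_norm_smul_sub_lt (G := K) f.continuous
    (by norm_num : (0 : ℝ) < 1 / 3)
  obtain ⟨W, hW, hWU⟩ := (mem_nhds_subtype _ _ _).1 hU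
  have hχ : χ ∈ {ω | f ω < 1 / 3} := by simp [hfχ rfl]
  have hψ : ψ ∈ {ω | 2 / 3 < f ω} := by norm_num [hfψ rfl]
  refine Set.disjoint_left.1 (disjoint_closure_of_smul_notMem hW ?_)
    (lift_base_mem_closure (isOpen_lt f.continuous continuous_const) hχ)
    (hχψ ▸ lift_base_mem_closure (isOpen_lt continuous_const f.continuous) hψ)
  rintro u hu _ ⟨k, hk : f _ < 1 / 3, rfl⟩ ⟨l, hl : 2 / 3 < f _, hlk⟩
  obtain rfl : (l * k⁻¹ : K) = u := by simp [hlk]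
  have f_sub_lt := (le_abs_self _).trans_lt (hUf (l * k⁻¹) (hWU hu) (k • base ⊥))
  rw [smul_smul, inv_mul_cancel_right] at f_sub_lt
  linarith

end SeparatedSets

end Samuel

theorem IsMicrotransitiveAt.mem_closure_orbit_base {G : Type u} [Group G] [TopologicalSpace G]
    [IsTopologicalGroup G] {X : Type*} [TopologicalSpace X] [CompactSpace X] [T2Space X]
    [MulAction G X] [ContinuousSMul G X] {x : X} (hx : IsMicrotransitiveAt G x) {H : Subgroup G}
    (hH : H ≤ stabilizer G x) {χ : Samuel H} (hχ : Samuel.lift x hH χ = x) :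
    χ ∈ closure (orbit (stabilizer G x) (Samuel.base H)) :=
  hx.mem_closure_orbit_stabilizer (Samuel.isGMap_lift x hH) (Samuel.lift_base x hH)
    (Samuel.dense_orbit_base χ) hχ

theorem extremelyAmenable_of_nonempty_fixedPoints_samuel {G : Type u} [Group G] [TopologicalSpace G]
    [IsTopologicalGroup G] (h : (fixedPoints G (Samuel (⊥ : Subgroup G))).Nonempty) :
    ExtremelyAmenable G := fun Y _ _ _ _ _ _ =>
  let ⟨χ, hχ⟩ := h
  ⟨Samuel.lift (Classical.arbitrary Y) bot_le χ, fun g => by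
    rw [← (Samuel.isGMap_lift _ _).map_smul, hχ]⟩

theorem ExtremelyAmenable.of_surjective {G H : Type u} [Group G] [TopologicalSpace G] [Group H]
    [TopologicalSpace H] (hG : ExtremelyAmenable G) {f : G →* H} (hf : Continuous f)
    (hf_surj : Function.Surjective f) : ExtremelyAmenable H := fun Y _ _ _ _ _ _ => by
  let := MulAction.compHom Y f
  have : ContinuousSMul G Y := ⟨(hf.comp continuous_fst).smul continuous_snd⟩
  obtain ⟨y, hy⟩ := hG Y
  exact ⟨y, hf_surj.forall.2 hy⟩

theorem ExtremelyAmenable.exists_fixed_over {G : Type u} [Group G] [TopologicalSpace G]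
    [IsTopologicalGroup G] (hG : ExtremelyAmenable G) {X Y : Type*} [TopologicalSpace X]
    [T2Space X] [MulAction G X] [TopologicalSpace Y] [CompactSpace Y] [T2Space Y]
    [MulAction G Y] [ContinuousSMul G Y] {f : Y → X} (hf : IsGMap G f) {y : Y}
    (hy : f y ∈ fixedPoints G X) : ∃ z ∈ fixedPoints G Y, f z = f y := by
  obtain ⟨χ, hχ⟩ := hG (Samuel (⊥ : Subgroup G))
  have f_lift : f ∘ Samuel.lift y bot_le = fun _ : Samuel (⊥ : Subgroup G) => f y :=
    Samuel.gMap_ext (hf.comp (Samuel.isGMap_lift y bot_le))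
      ⟨continuous_const, fun g _ => (hy g).symm⟩ (by rw [Function.comp_apply, Samuel.lift_base])
  exact ⟨Samuel.lift y bot_le χ, fun g => by rw [← (Samuel.isGMap_lift y bot_le).map_smul, hχ],
    congrFun f_lift χ⟩

namespace IsUniversalMinimalFlow

variable {G : Type u} [Group G] [TopologicalSpace G] [IsTopologicalGroup G]
  {M : Type m} [TopologicalSpace M] [CompactSpace M] [T2Space M] [MulAction G M]
  [ContinuousSMul G M]

/-- Let `q` be a point over `p` in a minimal subflow `N` of the Samuel compactification of `G`.
Since `N → M` is injective, the stabilizer of `p` fixes `q`, which by microtransitivity lies in the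
copy of the Samuel compactification of the stabilizer. -/
theorem extremelyAmenable_stabilizer (hM : IsUniversalMinimalFlow G M) {p : M}
    (hp : IsMicrotransitiveAt G p) : ExtremelyAmenable (stabilizer G p) := by
  have := hM.isMinimal
  obtain ⟨N, hN⟩ := IsSubflow.exists_minimal (G := G) (X := Samuel (⊥ : Subgroup G))
  have := IsSubflow.isMinimal_of_minimal hN
  have lift_p := Samuel.isGMap_lift (G := G) (H := ⊥) p bot_le
  have hc := lift_p.comp hN.prop.isGMap_val
  obtain ⟨q, hq⟩ := hc.surjective_of_isMinimal p
  have smul_q (k : stabilizer G p) : k • q.1 = q.1 := by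
    have : (k : G) • q = q := hM.injective hc (by rw [hc.map_smul, hq, mem_stabilizer_iff.1 k.2])
    exact congrArg Subtype.val this
  obtain ⟨χ, hχ⟩ : q.1 ∈ Set.range (Samuel.lift (G := stabilizer G p)
      (H := ⊥) (Samuel.base (⊥ : Subgroup G)) bot_le) := by
    rw [Samuel.range_lift]
    exact hp.mem_closure_orbit_base bot_le hq
  refine extremelyAmenable_of_nonempty_fixedPoints_samuel ⟨χ, fun k =>
    Samuel.injective_lift_base ?_⟩
  rw [(Samuel.isGMap_lift _ _).map_smul, hχ, smul_q]

end IsUniversalMinimalFlow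

section Cover

variable {G : Type u} [Group G] [TopologicalSpace G] [IsTopologicalGroup G]
  {X : Type*} [TopologicalSpace X] [CompactSpace X] [T2Space X] [MulAction G X]
  [ContinuousSMul G X] {x : X}

namespace IsMicrotransitiveAt

theorem isGIrreducible_lift (hx : IsMicrotransitiveAt G x) (hx_dense : Dense (orbit G x))
    {H : Subgroup G} (hH : H ≤ stabilizer G x)
    (h : ∀ χ ∈ closure (orbit (stabilizer G x) (Samuel.base H)),
      Samuel.base H ∈ closure (orbit (stabilizer G x) χ)) :
    IsGIrreducible G (Samuel.lift x hH) := by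
  have lift_x := Samuel.isGMap_lift x hH
  have lift_surj : Function.Surjective (Samuel.lift x hH) :=
    lift_x.surjective_of_dense_orbit (x := Samuel.base H) (by rwa [Samuel.lift_base])
  refine IsGExtension.isGIrreducible_of_dense_orbit ⟨lift_x, lift_surj⟩ (y := x) fun χ hχ => ?_
  have base_mem : Samuel.base H ∈ closure (orbit G χ) :=
    closure_mono (orbit_subgroup_subset _ χ) (h χ (hx.mem_closure_orbit_base hH hχ))
  exact dense_iff_closure_eq.2
    ((IsSubflow.closure_orbit χ).eq_univ_of_dense_orbit base_mem Samuel.dense_orbit_base)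

theorem isMinimal_samuel_stabilizer [MulAction.IsMinimal G X] (hx : IsMicrotransitiveAt G x) :
    MulAction.IsMinimal G (Samuel (stabilizer G x)) := by
  refine (hx.isGIrreducible_lift (dense_orbit G x) le_rfl fun χ hχ => ?_).isMinimal
  have orbit_base : orbit (stabilizer G x) (Samuel.base (stabilizer G x)) ⊆ {Samuel.base _} :=
    Set.range_subset_iff.2 fun k => Samuel.le_stabilizer_base k.2
  obtain rfl := closure_minimal orbit_base isClosed_singleton hχ
  exact hχ

theorem isGIrreducible_lift_map_subtype (hx : IsMicrotransitiveAt G x)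
    (hx_dense : Dense (orbit G x)) (K : Subgroup (stabilizer G x))
    [MulAction.IsMinimal (stabilizer G x) (Samuel K)] :
    IsGIrreducible G (Samuel.lift x (Subgroup.map_subtype_le K)) := by
  refine hx.isGIrreducible_lift hx_dense _ fun χ hχ => ?_
  have hK : K ≤ stabilizer (stabilizer G x) (Samuel.base (K.map (stabilizer G x).subtype)) :=
    Subgroup.map_le_iff_le_comap.1 Samuel.le_stabilizer_base
  rw [← Samuel.range_lift _ hK] at hχ
  obtain ⟨ψ, rfl⟩ := hχ
  rw [← (Samuel.isGMap_lift _ hK).image_closure_orbit,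
    (dense_orbit (stabilizer G x) ψ).closure_eq]
  exact ⟨Samuel.base K, trivial, Samuel.lift_base _ hK⟩

end IsMicrotransitiveAt

theorem IsUniversalMinimalFlow.flowIsomorphic_samuel
    (hX : IsUniversalMinimalFlow G X) (hx : IsMicrotransitiveAt G x) :
    FlowIsomorphic G X (Samuel (stabilizer G x)) := by
  have := hX.isMinimal
  have := hx.isMinimal_samuel_stabilizer
  have lift_x := Samuel.isGMap_lift (G := G) x le_rfl
  exact FlowIsomorphic.symm
    ⟨Samuel.lift x le_rfl, lift_x, hX.injective lift_x, lift_x.surjective_of_isMinimal⟩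

theorem ExtremelyAmenable.isGProjectiveCover_lift {K : Subgroup G} (hK : ExtremelyAmenable K)
    {hKx : K ≤ stabilizer G x} (h : IsGIrreducible G (Samuel.lift x hKx)) :
    IsGProjectiveCover.{_, _, _, w} G (Samuel.lift x hKx) := by
  refine ⟨h, fun Z _ _ _ _ _ π hπ => ?_⟩
  obtain ⟨z, rfl⟩ := hπ.surjective x
  obtain ⟨z₀, hz₀, hπz₀⟩ := hK.exists_fixed_over (hπ.toIsGMap.restrict K) (y := z)
    fun k => hKx k.2
  have K_le : K ≤ stabilizer G z₀ := fun k hk => hz₀ ⟨k, hk⟩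
  exact ⟨Samuel.lift z₀ K_le, Samuel.isGMap_lift z₀ K_le, Samuel.gMap_ext
    (hπ.toIsGMap.comp (Samuel.isGMap_lift z₀ K_le)) (Samuel.isGMap_lift _ hKx)
    (by rw [Function.comp_apply, Samuel.lift_base, Samuel.lift_base, hπz₀])⟩

end Cover

end

theorem mainTheorem6_general (G : Type u) [Group G] [TopologicalSpace G] [IsTopologicalGroup G]
    (X : Type v) [TopologicalSpace X] [CompactSpace X] [T2Space X] [MulAction G X]
    [ContinuousSMul G X]
    (x : X) (hx : IsMicrotransitiveAt G x) (hx_dense : Dense (orbit G x))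
    (M : Type m) [TopologicalSpace M] [CompactSpace M] [T2Space M]
    [MulAction (stabilizer G x) M] [ContinuousSMul (stabilizer G x) M]
    (hM : IsUniversalMinimalFlow (stabilizer G x) M)
    (hMc : ∃ p : M, IsMicrotransitiveAt (stabilizer G x) p) :
    (∃ K : Subgroup (stabilizer G x), IsClosed (K : Set (stabilizer G x)) ∧
      ExtremelyAmenable K ∧ FlowIsomorphic (stabilizer G x) M (Samuel K)) ∧
    ∀ K : Subgroup (stabilizer G x),
      ExtremelyAmenable K → FlowIsomorphic (stabilizer G x) M (Samuel K) →
      ∃ φ : Samuel (K.map (stabilizer G x).subtype) → X,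
        IsGProjectiveCover.{u, v, u, w} G φ := by
  have := hM.isMinimal
  refine ⟨?_, fun K hK hMK => ?_⟩
  · obtain ⟨p, hp⟩ := hMc
    exact ⟨stabilizer _ p, isClosed_stabilizer p, hM.extremelyAmenable_stabilizer hp,
      hM.flowIsomorphic_samuel hp⟩
  · have := hMK.isMinimal
    have hK_map : ExtremelyAmenable (K.map (stabilizer G x).subtype) :=
      hK.of_surjective (f := (stabilizer G x).subtype.subgroupMap K)
        ((continuous_subtype_val.comp continuous_subtype_val).subtype_mk _)
        (MonoidHom.subgroupMap_surjective _ K)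
    exact ⟨_, hK_map.isGProjectiveCover_lift (hx.isGIrreducible_lift_map_subtype hx_dense K)⟩

theorem mainTheorem6 (G : Type u) [Group G] [TopologicalSpace G] [IsTopologicalGroup G]
    [PolishSpace G]
    (X : Type v) [TopologicalSpace X] [CompactSpace X] [T2Space X] [MulAction G X]
    [ContinuousSMul G X]
    (x : X) (hx : orbit G x ∈ residual X)
    (M : Type m) [TopologicalSpace M] [CompactSpace M] [T2Space M]
    [MulAction (stabilizer G x) M] [ContinuousSMul (stabilizer G x) M]
    (hM : IsUniversalMinimalFlow (stabilizer G x) M)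
    (hMc : ∃ p : M, orbit (stabilizer G x) p ∈ residual M) :
    (∃ K : Subgroup (stabilizer G x), IsClosed (K : Set (stabilizer G x)) ∧
      ExtremelyAmenable K ∧ FlowIsomorphic (stabilizer G x) M (Samuel K)) ∧
    ∀ K : Subgroup (stabilizer G x), IsClosed (K : Set (stabilizer G x)) →
      ExtremelyAmenable K → FlowIsomorphic (stabilizer G x) M (Samuel K) →
      ∃ φ : Samuel (K.map (stabilizer G x).subtype) → X,
        IsGProjectiveCover.{u, v, u, w} G φ := by
  have : PolishSpace (stabilizer G x) := (isClosed_stabilizer x).polishSpace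
  have : Nonempty X := ⟨x⟩
  have := hM.nonempty
  obtain ⟨p, hp⟩ := hMc
  obtain ⟨hK, hφ⟩ := mainTheorem6_general G X x
    (isMicrotransitiveAt_of_not_isMeagre_orbit (not_isMeagre_of_mem_residual hx))
    (dense_of_mem_residual hx) M hM
    ⟨p, isMicrotransitiveAt_of_not_isMeagre_orbit (not_isMeagre_of_mem_residual hp)⟩
  exact ⟨hK, fun K _ => hφ K⟩
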